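/- Let $\boldsymbol{x}\sim\mathcal N(0,\Sigma_x)$ be a Gaussian random vector in $\mathbb R^p$ with $\Sigma_x\succ O$. Two senders observe $\boldsymbol{x}$ and simultaneously commit to Borel policies $\eta_1,\eta_2:\mathbb R^p\to\mathbb R^p$; the receiver observes $\boldsymbol{y}_j=\eta_j(\boldsymbol{x})$, $j=1,2$, and takes the action $\boldsymbol{u}=\gamma(\boldsymbol{y}_1,\boldsymbol{y}_2)\in\mathbb R^t$, where $\gamma:\mathbb R^{2p}\to\mathbb R^t$ is Borel. The expected costs are $J_k(\eta_1,\eta_2;\gamma)=\mathbb E\|Q_k\boldsymbol{x}+R_k\boldsymbol{u}\|^2$ for $k\in\{1,2,r\}$, with $Q_k\in\mathbb R^{q\times p}$, $R_k\in\mathbb R^{q\times t}$ and $R_r^\top R_r$ invertible. A best-response strategy of the receiver is a map $\gamma^*$ that assigns to each pair $(\eta_1,\eta_2)$ a minimizer $\gamma^*(\eta_1,\eta_2)$ of $\gamma\mapsto J_r(\eta_1,\eta_2;\gamma)$. The policies $(\eta_1,\eta_2)$ together with such a $\gamma^*$ form a Nash equilibrium among the senders if no sender $j$ can decrease $J_j(\eta_1,\eta_2;\gamma^*(\eta_1,\eta_2))$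 by changing $\eta_j$ alone to another Borel policy, the receiver re-responding through $\gamma^*$. Write $\hat{\boldsymbol{x}}=\mathbb E[\boldsymbol{x}\mid\boldsymbol{y}_1,\boldsymbol{y}_2]$; the posterior covariance induced by $(\eta_1,\eta_2)$ is $\mathbb E[\hat{\boldsymbol{x}}\hat{\boldsymbol{x}}^\top]$. For $j=1,2$ put $\Lambda_j=R_j(R_r^\top R_r)^{-1}R_r^\top Q_r$ and $V_j=\Lambda_j^\top\Lambda_j-\Lambda_j^\top Q_j-Q_j^\top\Lambda_j$. Let $\Sigma^*$ be obtained as follows, where $(i,k)$ is either $(1,2)$ or $(2,1)$ and $\|\cdot\|_*$ is the nuclear norm (sum of the singular values): 1. let $S_i$ minimize $\operatorname{Tr}(V_iS)$ over $\Sigma_x\succeq S\succeq O$, and let $\Sigma_i^*$ minimize $\|\Sigma_x^{-1/2}S\Sigma_x^{-1/2}\|_*$ over the $S$ with $\Sigma_x\succeq S\succeq O$ and $\operatorname{Tr}(V_iS)\le\operatorname{Tr}(V_iS_i)$; 2. let $S_k$ minimize $\operatorname{Tr}(V_kS)$ over $\Sigma_x\succeq S\succeq\Sigma_i^*$, and let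 $\Sigma^*$ minimize $\|\Sigma_x^{-1/2}S\Sigma_x^{-1/2}\|_*$ over the $S$ with $\Sigma_x\succeq S\succeq\Sigma_i^*$ and $\operatorname{Tr}(V_kS)\le\operatorname{Tr}(V_kS_k)$. Let $P'=\Sigma_x^{-1/2}\Sigma^*\Sigma_x^{-1/2}=U_{P'}\Lambda_{P'}U_{P'}^\top$ with $U_{P'}$ orthogonal and $\Lambda_{P'}$ diagonal, let $L^\top=\Sigma_x^{-1/2}U_{P'}\Lambda_{P'}$, and let $G_1,G_2\in\mathbb R^{p\times p}$ be arbitrary (full-rank) matrices with orthonormal columns. Then the receiver has a best-response strategy, and, with every best-response strategy of the receiver, the noiseless linear policies $\eta_1(\boldsymbol{x})=G_1L\boldsymbol{x}$ and $\eta_2(\boldsymbol{x})=G_2L\boldsymbol{x}$ form a Nash equilibrium among the senders. They induce the posterior covariance $\Sigma^*$, which is of the form $\Sigma^*=\Sigma_i^*+(\Sigma_x-\Sigma_i^*)^{1/2}P(\Sigma_x-\Sigma_i^*)^{1/2}$ for some orthogonal projection matrix $P$. -/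

import Mathlib

open MeasureTheory ProbabilityTheory
open scoped ENNReal Matrix MatrixOrder

noncomputable section

namespace SignalingGame

/-- Column vectors with the Euclidean norm. -/
abbrev Vec (n : ℕ) : Type := EuclideanSpace ℝ (Fin n)

/-- Multiplication of a Euclidean vector by a matrix. -/
abbrev act {m n : ℕ} (A : Matrix (Fin m) (Fin n) ℝ) (v : Vec n) : Vec m :=
  Matrix.toEuclideanLin A v

/-- The matrices of the quadratic losses `‖Qᵢ x + Rᵢ u‖²` of the two senders `i : Fin 2`
and `‖Qr x + Rr u‖²` of the receiver. -/
structure Losses (p q t : ℕ) where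
  Q : Fin 2 → Matrix (Fin q) (Fin p) ℝ
  R : Fin 2 → Matrix (Fin q) (Fin t) ℝ
  Qr : Matrix (Fin q) (Fin p) ℝ
  Rr : Matrix (Fin q) (Fin t) ℝ

/-! ### Policies, costs and equilibrium -/

/-- Policies of a sender: all Borel measurable maps `ℝᵖ → ℝᵖ`. -/
abbrev SenderPolicy (p : ℕ) : Type := {η : Vec p → Vec p // Measurable η}

/-- Policies of the receiver: all Borel measurable maps from the pair of signals to `ℝᵗ`. -/
abbrev ReceiverPolicy (p t : ℕ) : Type := {γ : (Fin 2 → Vec p) → Vec t // Measurable γ}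

/-- The noiseless linear policy `x ↦ A x`. -/
def linearPolicy {p : ℕ} (A : Matrix (Fin p) (Fin p) ℝ) : SenderPolicy p :=
  ⟨fun x => act A x, (LinearMap.continuous_of_finiteDimensional (Matrix.toEuclideanLin A)).measurable⟩

section game

variable {Ω : Type*} [MeasurableSpace Ω] {p q t : ℕ}

/-- The pair of signals `(η₁(x), η₂(x))` received by the receiver. -/
def signals (X : Ω → Vec p) (η : Fin 2 → SenderPolicy p) (ω : Ω) : Fin 2 → Vec p :=
  fun i => (η i).1 (X ω)

/-- The expected cost `𝔼 ‖Q x + R γ(y₁, y₂)‖²`; it is nonnegative and a priori possibly infinite. -/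
def expectedCost (P : Measure Ω) (X : Ω → Vec p)
    (Q : Matrix (Fin q) (Fin p) ℝ) (R : Matrix (Fin q) (Fin t) ℝ)
    (η : Fin 2 → SenderPolicy p) (γ : ReceiverPolicy p t) : ℝ≥0∞ :=
  ∫⁻ ω, ENNReal.ofReal (‖act Q (X ω) + act R (γ.1 (signals X η ω))‖ ^ 2) ∂P

/-- `γ` is a strategy of the receiver (a policy for each pair of committed sender policies) that
selects, for every pair of sender policies, a minimizer of the expected cost of the receiver. -/
def IsBestResponseStrategy (P : Measure Ω) (X : Ω → Vec p) (𝓛 : Losses p q t)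
    (γ : (Fin 2 → SenderPolicy p) → ReceiverPolicy p t) : Prop :=
  ∀ (η : Fin 2 → SenderPolicy p) (γ' : ReceiverPolicy p t),
    expectedCost P X 𝓛.Qr 𝓛.Rr η (γ η) ≤ expectedCost P X 𝓛.Qr 𝓛.Rr η γ'

/-- Nash equilibrium among the senders, the receiver following with a best response. -/
structure IsEquilibrium (P : Measure Ω) (X : Ω → Vec p) (𝓛 : Losses p q t)
    (η : Fin 2 → SenderPolicy p)
    (γ : (Fin 2 → SenderPolicy p) → ReceiverPolicy p t) : Prop where
  best_response : IsBestResponseStrategy P X 𝓛 γ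
  no_deviation : ∀ (i : Fin 2) (η' : SenderPolicy p),
    expectedCost P X (𝓛.Q i) (𝓛.R i) η (γ η) ≤
      expectedCost P X (𝓛.Q i) (𝓛.R i)
        (Function.update η i η') (γ (Function.update η i η'))

/-- The posterior mean `x̂ = 𝔼[x | y₁, y₂]` of the receiver. -/
def posteriorMean (P : Measure Ω) (X : Ω → Vec p) (η : Fin 2 → SenderPolicy p) : Ω → Vec p :=
  P[X | MeasurableSpace.comap (signals X η) inferInstance]

/-- The posterior covariance `𝔼[x̂ x̂ᵀ]` (the state has mean zero). -/
def posteriorCovariance (P : Measure Ω) (X : Ω → Vec p) (η : Fin 2 → SenderPolicy p) :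
    Matrix (Fin p) (Fin p) ℝ :=
  Matrix.of fun j k => ∫ ω, posteriorMean P X η ω j * posteriorMean P X η ω k ∂P

end game

/-! ### The sequential semidefinite programs -/

/-- `Λᵢ = Rᵢ (Rrᵀ Rr)⁻¹ Rrᵀ Qr`. -/
def Losses.lam {p q t : ℕ} (𝓛 : Losses p q t) (i : Fin 2) : Matrix (Fin q) (Fin p) ℝ :=
  𝓛.R i * (𝓛.Rrᵀ * 𝓛.Rr)⁻¹ * 𝓛.Rrᵀ * 𝓛.Qr

/-- `Vᵢ = Λᵢᵀ Λᵢ - Λᵢᵀ Qᵢ - Qᵢᵀ Λᵢ`. -/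
def Losses.V {p q t : ℕ} (𝓛 : Losses p q t) (i : Fin 2) : Matrix (Fin p) (Fin p) ℝ :=
  (𝓛.lam i)ᵀ * 𝓛.lam i - (𝓛.lam i)ᵀ * 𝓛.Q i - (𝓛.Q i)ᵀ * 𝓛.lam i

/-- The nuclear norm: the sum of the singular values, i.e. of the square roots of the
eigenvalues of `Aᵀ A`. -/
def nuclearNorm {p : ℕ} (A : Matrix (Fin p) (Fin p) ℝ) : ℝ :=
  ∑ j, √((Matrix.isHermitian_conjTranspose_mul_self A).eigenvalues j)

/-- The normalization `Σx^{-1/2} S Σx^{-1/2}`. -/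
def whiten {p : ℕ} (Sx S : Matrix (Fin p) (Fin p) ℝ) : Matrix (Fin p) (Fin p) ℝ :=
  (CFC.sqrt Sx)⁻¹ * S * (CFC.sqrt Sx)⁻¹

/-- One stage: `S'` is obtained by first computing a minimizer `S` of `Tr (V S)` over
`Σx ⪰ S ⪰ S₀` and then minimizing the nuclear norm of `Σx^{-1/2} S' Σx^{-1/2}` over
`Σx ⪰ S' ⪰ S₀` subject to `Tr (V S) ≥ Tr (V S')`. Intervals are in the Loewner order. -/
def IsStageOutput {p : ℕ} (Sx V S₀ S' : Matrix (Fin p) (Fin p) ℝ) : Prop :=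
  ∃ S ∈ Set.Icc S₀ Sx,
    IsMinOn (fun T => (V * T).trace) (Set.Icc S₀ Sx) S ∧
    S' ∈ Set.Icc S₀ Sx ∩ {T | (V * T).trace ≤ (V * S).trace} ∧
    IsMinOn (fun T => nuclearNorm (whiten Sx T))
      (Set.Icc S₀ Sx ∩ {T | (V * T).trace ≤ (V * S).trace}) S'

/-- `S` is a posterior covariance returned by the two-stage algorithm which treats sender `i`
first, with intermediate posterior covariance `S₁`, and the other sender second. -/
def IsAlgorithmOutput {p q t : ℕ} (Sx : Matrix (Fin p) (Fin p) ℝ) (𝓛 : Losses p q t)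
    (i : Fin 2) (S₁ S : Matrix (Fin p) (Fin p) ℝ) : Prop :=
  IsStageOutput Sx (𝓛.V i) 0 S₁ ∧ IsStageOutput Sx (𝓛.V i.rev) S₁ S

end SignalingGame

end

/-!
The best response of the receiver is the certainty-equivalent action `u = -K x̂`, where
`K = (Rrᵀ Rr)⁻¹ Rrᵀ Qr`, and it is almost surely unique on the signals that are sent. Hence the cost
of sender `j` is a constant plus `Tr (Vⱼ S)`, with `S` the posterior covariance.

When both senders reveal the same information, a deviation of one of them can only add to it, so it
leads to a posterior covariance `T` with `Σ* ≤ T ≤ Σx`, and it suffices that `Σ*` minimizes both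
`Tr (Vⱼ T)` over these `T`. For the sender treated last this is the second stage. For the sender
treated first, translating `[Σ*, Σx]` by `Σᵢ* - Σ*` keeps it inside `[0, Σx]`, over which `Σᵢ*` is
optimal.

It remains to realize `Σ*` by linear policies. The minimal nuclear norm forces
`Z = Σx^{-1/2} Σ* Σx^{-1/2}` to be a projection. For Gaussian `x`, the observation
`y = Z Σx^{-1/2} x` satisfies `𝔼[x yᵀ] = Σx^{1/2} Z` and `𝔼[y yᵀ] = Z`, so the conditional mean of
`x` given `y` is `Σx^{1/2} y`, with covariance `Σx^{1/2} Z Σx^{1/2} = Σ*`.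
-/

namespace SignalingGame

/-! ### Contractions above a projection -/

section StarOrderedRing

variable {R : Type*} [Ring R] [PartialOrder R] [StarRing R] [StarOrderedRing R] {a p : R}

theorem mul_self_le_self (h₀ : 0 ≤ a) (h₁ : a ≤ 1) : a * a ≤ a := by
  have key : a - a * a = a * (1 - a) * a + (1 - a) * a * (1 - a) := by noncomm_ring
  rw [← sub_nonneg, key]
  exact add_nonneg (conjugate_nonneg_of_nonneg (sub_nonneg.2 h₁) h₀)
    (conjugate_nonneg_of_nonneg h₀ (sub_nonneg.2 h₁))

theorem add_self_sub_mul_self_le_one (ha : IsSelfAdjoint a) : a + a - a * a ≤ 1 := by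
  have key : 1 - (a + a - a * a) = (1 - a) * (1 - a) := by noncomm_ring
  rw [← sub_nonneg, key]
  exact ((IsSelfAdjoint.one R).sub ha).mul_self_nonneg

theorem le_mul_self_of_mul_eq_right (ha : IsSelfAdjoint a) (hp : IsStarProjection p)
    (h : a * p = p) : p ≤ a * a := by
  have h' : p * a = p := by
    simpa only [star_mul, ha.star_eq, hp.isSelfAdjoint.star_eq] using congrArg star h
  have key : a * a - p = (a - p) * (a - p) := by
    rw [sub_mul, mul_sub, mul_sub, h, h', hp.isIdempotentElem.eq, sub_self, sub_zero]
  rw [← sub_nonneg, key]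
  exact (ha.sub hp.isSelfAdjoint).mul_self_nonneg

end StarOrderedRing

section Matrix

open scoped ComplexOrder

variable {n 𝕜 : Type*} [Fintype n] [RCLike 𝕜] {A B M P T : Matrix n n 𝕜}

theorem eq_of_le_of_trace_le (h : A ≤ B) (ht : B.trace ≤ A.trace) : A = B := by
  have hBA := Matrix.nonneg_iff_posSemidef.1 (sub_nonneg.2 h)
  have htr : (B - A).trace = 0 :=
    le_antisymm (by rwa [Matrix.trace_sub, sub_nonpos]) hBA.trace_nonneg
  exact (sub_eq_zero.1 (hBA.trace_eq_zero_iff.1 htr)).symm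

variable [DecidableEq n]

theorem mul_eq_right_of_isStarProjection_of_le (hP : IsStarProjection P) (h : P ≤ T)
    (h₁ : T ≤ 1) : T * P = P := by
  set D := 1 - T
  have hD : 0 ≤ D := sub_nonneg.2 h₁
  have hPDP : P * D * P ≤ 0 := by
    calc P * D * P ≤ P * (1 - P) * P :=
          hP.isSelfAdjoint.conjugate_le_conjugate (sub_le_sub_left h 1)
      _ = 0 := by rw [hP.mul_one_sub_self, zero_mul]
  have hDD : D * D ≤ D := mul_self_le_self hD (sub_le_self 1 (hP.nonneg.trans h))
  have hDP : star (D * P) * (D * P) = 0 := by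
    refine le_antisymm ?_ (star_mul_self_nonneg _)
    calc star (D * P) * (D * P) = P * (D * D) * P := by
          rw [star_mul, hP.isSelfAdjoint.star_eq, hD.isSelfAdjoint.star_eq]
          simp only [mul_assoc]
      _ ≤ P * D * P := hP.isSelfAdjoint.conjugate_le_conjugate hDD
      _ ≤ 0 := hPDP
  have := Matrix.conjTranspose_mul_self_eq_zero.1 hDP
  rwa [sub_mul, one_mul, sub_eq_zero, eq_comm] at this

end Matrix

/-! ### Polar decomposition -/

section Polar

theorem exists_linearIsometry_comp_eq {𝕜 E V : Type*} [RCLike 𝕜] [AddCommGroup E] [Module 𝕜 E]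
    [NormedAddCommGroup V] [InnerProductSpace 𝕜 V] [FiniteDimensional 𝕜 V] {f g : E →ₗ[𝕜] V}
    (h : ∀ x, ‖f x‖ = ‖g x‖) : ∃ W : V →ₗᵢ[𝕜] V, W.toLinearMap ∘ₗ f = g := by
  obtain ⟨s, hs⟩ := f.rangeRestrict.exists_rightInverse_of_surjective f.range_rangeRestrict
  have hfs (y : f.range) : f (s y) = y := congrArg Subtype.val (LinearMap.congr_fun hs y)
  let W₀ : f.range →ₗᵢ[𝕜] V := ⟨g ∘ₗ s, fun y => by
    rw [LinearMap.comp_apply, ← h, hfs, Submodule.coe_norm]⟩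
  refine ⟨W₀.extend, LinearMap.ext fun x => ?_⟩
  have hker : ‖f (s (f.rangeRestrict x) - x)‖ = 0 := by
    rw [map_sub, hfs, LinearMap.codRestrict_apply, sub_self, norm_zero]
  rw [h, map_sub, norm_eq_zero, sub_eq_zero] at hker
  exact (W₀.extend_apply (f.rangeRestrict x)).trans hker

variable {n 𝕜 : Type*} [Fintype n] [RCLike 𝕜] {A B Z : Matrix n n 𝕜}

theorem norm_toEuclideanLin_eq_of_conjTranspose_mul_self_eq [DecidableEq n] (h : Aᴴ * A = Bᴴ * B)
    (x : EuclideanSpace 𝕜 n) : ‖A.toEuclideanLin x‖ = ‖B.toEuclideanLin x‖ := by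
  have key (C : Matrix n n 𝕜) :
      inner 𝕜 (C.toEuclideanLin x) (C.toEuclideanLin x) =
        inner 𝕜 x ((Cᴴ * C).toEuclideanLin x) := by
    rw [Matrix.toEuclideanLin, Matrix.toLpLin_mul_same, LinearMap.comp_apply,
      Matrix.toEuclideanLin_conjTranspose_eq_adjoint, LinearMap.adjoint_inner_right]
  rw [@norm_eq_sqrt_re_inner 𝕜, @norm_eq_sqrt_re_inner 𝕜, key, key, h]

theorem exists_conjTranspose_mul_self_eq_one_and_eq_mul [DecidableEq n]
    (h : Aᴴ * A = Bᴴ * B) : ∃ W : Matrix n n 𝕜, Wᴴ * W = 1 ∧ A = W * B := by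
  obtain ⟨W, hW⟩ := exists_linearIsometry_comp_eq
    (norm_toEuclideanLin_eq_of_conjTranspose_mul_self_eq h.symm)
  refine ⟨Matrix.toEuclideanLin.symm W.toLinearMap, ?_, ?_⟩ <;>
    apply Matrix.toEuclideanLin.injective
  · rw [Matrix.toEuclideanLin, Matrix.toLpLin_mul_same,
      Matrix.toEuclideanLin_conjTranspose_eq_adjoint, LinearEquiv.apply_symm_apply,
      W.adjoint_comp_self', Matrix.toLpLin_one]
  · rw [Matrix.toEuclideanLin, Matrix.toLpLin_mul_same, LinearEquiv.apply_symm_apply, hW]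

theorem exists_isStarProjection_conjTranspose_mul_mul_eq (h : Aᴴ * A = Bᴴ * B)
    (hZ : IsStarProjection Z) : ∃ Pr, IsStarProjection Pr ∧ Aᴴ * Z * A = Bᴴ * Pr * B := by
  classical
  obtain ⟨W, hW, rfl⟩ := exists_conjTranspose_mul_self_eq_one_and_eq_mul h
  refine ⟨Wᴴ * Z * W, ⟨?_, hZ.isSelfAdjoint.conjugate' W⟩, ?_⟩
  · calc Wᴴ * Z * W * (Wᴴ * Z * W) = Wᴴ * (Z * (W * Wᴴ) * Z) * W := by simp only [mul_assoc]
      _ = Wᴴ * Z * W := by rw [mul_eq_one_comm.1 hW, mul_one, hZ.isIdempotentElem.eq]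
  · simp only [Matrix.conjTranspose_mul, mul_assoc]

end Polar

/-! ### Whitening and the semidefinite programs -/

section Stage

variable {p : ℕ} {Sx S S₀ S' T V Z : Matrix (Fin p) (Fin p) ℝ}

theorem nuclearNorm_eq_trace (hS : 0 ≤ S) : nuclearNorm S = S.trace := by
  set h := Matrix.isHermitian_conjTranspose_mul_self S
  have hSS : 0 ≤ Sᴴ * S := star_mul_self_nonneg S
  have hcfc : cfc Real.sqrt (Sᴴ * S) = S := by
    rw [← cfcₙ_eq_cfc, ← CFC.sqrt_eq_real_sqrt _ hSS, CFC.sqrt_eq_iff _ _ hSS hS,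
      ← Matrix.star_eq_conjTranspose, hS.isSelfAdjoint.star_eq]
  conv_rhs => rw [← hcfc, h.cfc_eq, Matrix.IsHermitian.cfc, Unitary.conjStarAlgAut_apply,
    Matrix.trace_mul_cycle]
  simp [nuclearNorm, Matrix.trace]

theorem isSelfAdjoint_sqrt : IsSelfAdjoint (CFC.sqrt Sx) := (CFC.sqrt_nonneg Sx).isSelfAdjoint

theorem isSelfAdjoint_inv_sqrt : IsSelfAdjoint (CFC.sqrt Sx)⁻¹ :=
  Matrix.IsHermitian.inv isSelfAdjoint_sqrt

theorem whiten_zero : whiten Sx 0 = 0 := by simp [whiten]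

theorem whiten_mono (h : S ≤ T) : whiten Sx S ≤ whiten Sx T :=
  isSelfAdjoint_inv_sqrt.conjugate_le_conjugate h

theorem isUnit_det_sqrt (hSx : Sx.PosDef) : IsUnit (CFC.sqrt Sx).det :=
  (Matrix.isUnit_iff_isUnit_det _).1 <| (CFC.isUnit_sqrt_iff Sx hSx.posSemidef.nonneg).2 hSx.isUnit

theorem sqrt_mul_sqrt (hSx : Sx.PosDef) : CFC.sqrt Sx * CFC.sqrt Sx = Sx :=
  CFC.sqrt_mul_sqrt_self Sx hSx.posSemidef.nonneg

theorem whiten_sqrt_mul_mul_sqrt (hSx : Sx.PosDef) :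
    whiten Sx (CFC.sqrt Sx * Z * CFC.sqrt Sx) = Z := by
  have h := isUnit_det_sqrt hSx
  rw [whiten, mul_assoc, mul_assoc, Matrix.mul_nonsing_inv _ h, mul_one, ← mul_assoc,
    Matrix.nonsing_inv_mul _ h, one_mul]

theorem sqrt_mul_whiten_mul_sqrt (hSx : Sx.PosDef) :
    CFC.sqrt Sx * whiten Sx S * CFC.sqrt Sx = S := by
  have h := isUnit_det_sqrt hSx
  rw [whiten, mul_assoc, mul_assoc, Matrix.nonsing_inv_mul _ h, mul_one, ← mul_assoc,
    Matrix.mul_nonsing_inv _ h, one_mul]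

theorem whiten_self (hSx : Sx.PosDef) : whiten Sx Sx = 1 := by
  simpa only [mul_one, sqrt_mul_sqrt hSx] using whiten_sqrt_mul_mul_sqrt (Z := 1) hSx

theorem whiten_mem_Icc (hSx : Sx.PosDef) (hS : S ∈ Set.Icc S₀ Sx) :
    whiten Sx S ∈ Set.Icc (whiten Sx S₀) 1 :=
  ⟨whiten_mono hS.1, whiten_self hSx ▸ whiten_mono hS.2⟩

theorem sqrt_mul_mul_sqrt_mem_Icc (hSx : Sx.PosDef) (hZ : Z ∈ Set.Icc (whiten Sx S₀) 1) :
    CFC.sqrt Sx * Z * CFC.sqrt Sx ∈ Set.Icc S₀ Sx := by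
  have hl := isSelfAdjoint_sqrt (Sx := Sx).conjugate_le_conjugate hZ.1
  have hu := isSelfAdjoint_sqrt (Sx := Sx).conjugate_le_conjugate hZ.2
  rw [sqrt_mul_whiten_mul_sqrt hSx] at hl
  rw [mul_one, sqrt_mul_sqrt hSx] at hu
  exact ⟨hl, hu⟩

namespace IsStageOutput

theorem mem_Icc (h : IsStageOutput Sx V S₀ S') : S' ∈ Set.Icc S₀ Sx := by
  obtain ⟨S, -, -, h, -⟩ := h
  exact h.1

theorem trace_mul_le (h : IsStageOutput Sx V S₀ S') (hT : T ∈ Set.Icc S₀ Sx) :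
    (V * S').trace ≤ (V * T).trace := by
  obtain ⟨S, -, hmin, h, -⟩ := h
  exact h.2.trans (isMinOn_iff.1 hmin T hT)

theorem trace_mul_le_of_le (h : IsStageOutput Sx V S₀ S') (hS : S' ≤ S) (hT : T ∈ Set.Icc S Sx) :
    (V * S).trace ≤ (V * T).trace := by
  have hshift : S' + (T - S) ∈ Set.Icc S₀ Sx :=
    ⟨h.mem_Icc.1.trans (le_add_of_nonneg_right (sub_nonneg.2 hT.1)),
      calc S' + (T - S) ≤ S + (T - S) := by gcongr
        _ ≤ Sx := (add_sub_cancel S T).trans_le hT.2⟩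
  have := h.trace_mul_le hshift
  rwa [mul_add, Matrix.trace_add, le_add_iff_nonneg_right, mul_sub, Matrix.trace_sub,
    sub_nonneg] at this

theorem trace_whiten_le (h : IsStageOutput Sx V S₀ S') (hS₀ : 0 ≤ whiten Sx S₀)
    (hT : T ∈ Set.Icc S₀ Sx) (hVT : (V * T).trace ≤ (V * S').trace) :
    (whiten Sx S').trace ≤ (whiten Sx T).trace := by
  obtain ⟨S, -, -, hS', hnuc⟩ := h
  have := isMinOn_iff.1 hnuc T ⟨hT, hVT.trans hS'.2⟩
  rwa [nuclearNorm_eq_trace (hS₀.trans (whiten_mono hS'.1.1)),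
    nuclearNorm_eq_trace (hS₀.trans (whiten_mono hT.1))] at this

-- In whitened coordinates `Z²` and `2Z - Z²` are feasible with midpoint the output `Z`, so `Z²` is
-- optimal as well; the nuclear norm, here the trace, then forces `Z ≤ Z²`.
theorem isStarProjection_whiten (hSx : Sx.PosDef) (h : IsStageOutput Sx V S₀ S')
    (h₀ : IsStarProjection (whiten Sx S₀)) : IsStarProjection (whiten Sx S') := by
  obtain ⟨hl, hu⟩ := whiten_mem_Icc hSx h.mem_Icc
  have hS' := sqrt_mul_whiten_mul_sqrt (S := S') hSx
  set Z := whiten Sx S'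
  have hZ₀ : 0 ≤ Z := h₀.nonneg.trans hl
  have hZZ : Z * Z ≤ Z := mul_self_le_self hZ₀ hu
  have hsq := sqrt_mul_mul_sqrt_mem_Icc hSx
    ⟨le_mul_self_of_mul_eq_right hZ₀.isSelfAdjoint h₀
      (mul_eq_right_of_isStarProjection_of_le h₀ hl hu), hZZ.trans hu⟩
  have hrefl := sqrt_mul_mul_sqrt_mem_Icc (Z := Z + Z - Z * Z) hSx
    ⟨hl.trans ((le_add_of_nonneg_right (sub_nonneg.2 hZZ)).trans_eq (add_sub_assoc Z Z _).symm),
      add_self_sub_mul_self_le_one hZ₀.isSelfAdjoint⟩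
  have hmid : (V * (CFC.sqrt Sx * (Z * Z) * CFC.sqrt Sx)).trace +
      (V * (CFC.sqrt Sx * (Z + Z - Z * Z) * CFC.sqrt Sx)).trace =
      (V * S').trace + (V * S').trace := by
    rw [← Matrix.trace_add, ← Matrix.trace_add, ← hS']
    congr 1
    noncomm_ring
  have htr := h.trace_whiten_le h₀.nonneg hsq (by linarith [h.trace_mul_le hrefl])
  rw [whiten_sqrt_mul_mul_sqrt hSx] at htr
  exact ⟨eq_of_le_of_trace_le hZZ htr, hZ₀.isSelfAdjoint⟩

end IsStageOutput

theorem exists_isStarProjection_eq_add (hSx : Sx.PosDef) (hS₀ : IsStarProjection (whiten Sx S₀))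
    (hS : IsStarProjection (whiten Sx S)) (hmem : S ∈ Set.Icc S₀ Sx) :
    ∃ Pr : Matrix (Fin p) (Fin p) ℝ, IsStarProjection Pr ∧
      S = S₀ + CFC.sqrt (Sx - S₀) * Pr * CFC.sqrt (Sx - S₀) := by
  set Q := 1 - whiten Sx S₀
  set Z := whiten Sx S - whiten Sx S₀ with hZ
  obtain ⟨hl, hu⟩ := whiten_mem_Icc hSx hmem
  have hQp : IsStarProjection Q := hS₀.one_sub
  have hZp : IsStarProjection Z :=
    hS₀.sub_of_mul_eq_right hS (mul_eq_right_of_isStarProjection_of_le hS₀ hl hu)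
  have hQZ : Q * Z = Z :=
    mul_eq_right_of_isStarProjection_of_le hZp (sub_le_sub_right hu _) (sub_le_self 1 hS₀.nonneg)
  have hZQ : Z * Q = Z := by
    simpa only [star_mul, hZp.isSelfAdjoint.star_eq, hQp.isSelfAdjoint.star_eq]
      using congrArg star hQZ
  set R := CFC.sqrt Sx
  have hQR : (Q * R)ᴴ = R * Q := by
    rw [Matrix.conjTranspose_mul]
    exact congrArg₂ (· * ·) isSelfAdjoint_sqrt hQp.isSelfAdjoint
  have hM : (CFC.sqrt (Sx - S₀))ᴴ = CFC.sqrt (Sx - S₀) := isSelfAdjoint_sqrt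
  have hgram : (Q * R)ᴴ * (Q * R) = (CFC.sqrt (Sx - S₀))ᴴ * CFC.sqrt (Sx - S₀) := by
    calc (Q * R)ᴴ * (Q * R) = R * (Q * Q) * R := by rw [hQR]; simp only [mul_assoc]
      _ = Sx - S₀ := by
        rw [hQp.isIdempotentElem.eq, mul_sub, mul_one, sub_mul, sqrt_mul_sqrt hSx,
          sqrt_mul_whiten_mul_sqrt hSx]
      _ = _ := by rw [hM, CFC.sqrt_mul_sqrt_self _ (sub_nonneg.2 (hmem.1.trans hmem.2))]
  obtain ⟨Pr, hPr, hZPr⟩ := exists_isStarProjection_conjTranspose_mul_mul_eq hgram hZp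
  refine ⟨Pr, hPr, eq_add_of_sub_eq' ?_⟩
  calc S - S₀ = R * Z * R := by
        rw [hZ, mul_sub, sub_mul, sqrt_mul_whiten_mul_sqrt hSx, sqrt_mul_whiten_mul_sqrt hSx]
    _ = (Q * R)ᴴ * Z * (Q * R) := by
        rw [hQR, mul_assoc R Q Z, hQZ, ← mul_assoc (R * Z), mul_assoc R Z Q, hZQ]
    _ = CFC.sqrt (Sx - S₀) * Pr * CFC.sqrt (Sx - S₀) := by rw [hZPr, hM]

namespace IsAlgorithmOutput

variable {q t : ℕ} {𝓛 : Losses p q t} {i : Fin 2} {S₁ : Matrix (Fin p) (Fin p) ℝ}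

theorem isStarProjection_whiten_left (hSx : Sx.PosDef) (h : IsAlgorithmOutput Sx 𝓛 i S₁ S) :
    IsStarProjection (whiten Sx S₁) :=
  h.1.isStarProjection_whiten hSx (by rw [whiten_zero]; exact .zero _)

theorem isStarProjection_whiten (hSx : Sx.PosDef) (h : IsAlgorithmOutput Sx 𝓛 i S₁ S) :
    IsStarProjection (whiten Sx S) :=
  h.2.isStarProjection_whiten hSx (h.isStarProjection_whiten_left hSx)

theorem trace_V_mul_le (h : IsAlgorithmOutput Sx 𝓛 i S₁ S) (j : Fin 2)
    (hT : T ∈ Set.Icc S Sx) : (𝓛.V j * S).trace ≤ (𝓛.V j * T).trace := by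
  obtain ⟨h₁, h₂⟩ := h
  have hS₁ : S₁ ≤ S := h₂.mem_Icc.1
  obtain rfl | rfl : j = i ∨ j = i.rev := by fin_cases i <;> fin_cases j <;> decide
  · exact h₁.trace_mul_le_of_le hS₁ hT
  · exact h₂.trace_mul_le ⟨hS₁.trans hT.1, hT.2⟩

end IsAlgorithmOutput

end Stage

/-! ### Second moments -/

section SecondMoment

variable {Ω : Type*} {mΩ : MeasurableSpace Ω} {P : Measure Ω} {l m n : ℕ}

theorem act_apply (A : Matrix (Fin m) (Fin n) ℝ) (v : Vec n) (j : Fin m) :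
    act A v j = ∑ i, A j i * v i := by
  simp [act, Matrix.toLpLin_apply, Matrix.mulVec, dotProduct]

theorem act_mul (A : Matrix (Fin l) (Fin m) ℝ) (B : Matrix (Fin m) (Fin n) ℝ) (v : Vec n) :
    act (A * B) v = act A (act B v) := by
  simp [act, Matrix.toLpLin_apply, Matrix.mulVec_mulVec]

theorem continuous_act (A : Matrix (Fin m) (Fin n) ℝ) : Continuous (act A) :=
  LinearMap.continuous_of_finiteDimensional (Matrix.toEuclideanLin A)

theorem memLp_act (A : Matrix (Fin m) (Fin n) ℝ) {f : Ω → Vec n} (hf : MemLp f 2 P) :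
    MemLp (fun ω => act A (f ω)) 2 P :=
  (LinearMap.toContinuousLinearMap (Matrix.toEuclideanLin A)).comp_memLp' hf

theorem integrable_eval_mul_eval {f : Ω → Vec m} {g : Ω → Vec n} (hf : MemLp f 2 P)
    (hg : MemLp g 2 P) (i : Fin m) (j : Fin n) : Integrable (fun ω => f ω i * g ω j) P :=
  (hf.eval_piLp i).integrable_mul (hg.eval_piLp j)

/-- The matrix `𝔼[f gᵀ]` of second moments of two random vectors, not centred at their means. -/
noncomputable def secondMoment (P : Measure Ω) (f : Ω → Vec m) (g : Ω → Vec n) :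
    Matrix (Fin m) (Fin n) ℝ :=
  Matrix.of fun i j => ∫ ω, f ω i * g ω j ∂P

theorem secondMoment_transpose (f : Ω → Vec m) (g : Ω → Vec n) :
    (secondMoment P f g)ᵀ = secondMoment P g f := by
  ext i j
  simp only [secondMoment, Matrix.transpose_apply, Matrix.of_apply, mul_comm]

theorem secondMoment_congr_ae {f f' : Ω → Vec m} {g g' : Ω → Vec n} (hf : f =ᵐ[P] f')
    (hg : g =ᵐ[P] g') : secondMoment P f g = secondMoment P f' g' := by
  ext i j
  refine integral_congr_ae ?_
  filter_upwards [hf, hg] with ω hf hg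
  rw [hf, hg]

theorem secondMoment_add_left {f f' : Ω → Vec m} {g : Ω → Vec n} (hf : MemLp f 2 P)
    (hf' : MemLp f' 2 P) (hg : MemLp g 2 P) :
    secondMoment P (fun ω => f ω + f' ω) g = secondMoment P f g + secondMoment P f' g := by
  ext i j
  simp only [secondMoment, Matrix.of_apply, Matrix.add_apply, PiLp.add_apply, add_mul]
  exact integral_add (integrable_eval_mul_eval hf hg i j) (integrable_eval_mul_eval hf' hg i j)

theorem secondMoment_add_right {f : Ω → Vec m} {g g' : Ω → Vec n} (hf : MemLp f 2 P)
    (hg : MemLp g 2 P) (hg' : MemLp g' 2 P) :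
    secondMoment P f (fun ω => g ω + g' ω) = secondMoment P f g + secondMoment P f g' := by
  rw [← secondMoment_transpose, secondMoment_add_left hg hg' hf, Matrix.transpose_add,
    secondMoment_transpose, secondMoment_transpose]

theorem secondMoment_sub_left {f f' : Ω → Vec m} {g : Ω → Vec n} (hf : MemLp f 2 P)
    (hf' : MemLp f' 2 P) (hg : MemLp g 2 P) :
    secondMoment P (fun ω => f ω - f' ω) g = secondMoment P f g - secondMoment P f' g := by
  have h := secondMoment_add_left (hf.sub hf') hf' hg
  simp only [Pi.sub_apply, sub_add_cancel] at h
  exact eq_sub_of_add_eq h.symm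

theorem secondMoment_add_self {f g : Ω → Vec n} (hf : MemLp f 2 P) (hg : MemLp g 2 P) :
    secondMoment P (fun ω => f ω + g ω) (fun ω => f ω + g ω) =
      secondMoment P f f + secondMoment P g g + (secondMoment P f g + (secondMoment P f g)ᵀ) := by
  have hfg : MemLp (fun ω => f ω + g ω) 2 P := hf.add hg
  rw [secondMoment_add_left hf hg hfg, secondMoment_add_right hf hf hg,
    secondMoment_add_right hg hf hg, secondMoment_transpose]
  abel

theorem secondMoment_act_left (A : Matrix (Fin l) (Fin m) ℝ) {f : Ω → Vec m} {g : Ω → Vec n}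
    (hf : MemLp f 2 P) (hg : MemLp g 2 P) :
    secondMoment P (fun ω => act A (f ω)) g = A * secondMoment P f g := by
  ext i j
  simp only [secondMoment, Matrix.of_apply, Matrix.mul_apply, act_apply, Finset.sum_mul,
    mul_assoc]
  rw [integral_finsetSum _ fun a _ => (integrable_eval_mul_eval hf hg a j).const_mul _]
  simp only [integral_const_mul]

theorem secondMoment_act_right (A : Matrix (Fin l) (Fin n) ℝ) {f : Ω → Vec m} {g : Ω → Vec n}
    (hf : MemLp f 2 P) (hg : MemLp g 2 P) :
    secondMoment P f (fun ω => act A (g ω)) = secondMoment P f g * Aᵀ := by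
  rw [← secondMoment_transpose, secondMoment_act_left A hg hf, Matrix.transpose_mul,
    secondMoment_transpose]

theorem secondMoment_act_self (A : Matrix (Fin l) (Fin n) ℝ) {f : Ω → Vec n}
    (hf : MemLp f 2 P) :
    secondMoment P (fun ω => act A (f ω)) (fun ω => act A (f ω)) = A * secondMoment P f f * Aᵀ := by
  rw [secondMoment_act_left A hf (memLp_act A hf), secondMoment_act_right A hf hf,
    Matrix.mul_assoc]

theorem secondMoment_self_nonneg {f : Ω → Vec n} (hf : MemLp f 2 P) : 0 ≤ secondMoment P f f := by
  rw [Matrix.nonneg_iff_posSemidef]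
  refine .of_dotProduct_mulVec_nonneg ?_ fun v => ?_
  · rw [Matrix.IsHermitian, Matrix.conjTranspose_eq_transpose_of_trivial, secondMoment_transpose]
  · have h : 0 ≤ secondMoment P (fun ω => act (Matrix.replicateRow (Fin 1) v) (f ω))
        (fun ω => act (Matrix.replicateRow (Fin 1) v) (f ω)) 0 0 :=
      integral_nonneg fun ω => mul_self_nonneg _
    rw [secondMoment_act_self _ hf, Matrix.mul_assoc, Matrix.transpose_replicateRow] at h
    simpa [Matrix.mul_apply, dotProduct, Matrix.mulVec] using h

theorem lintegral_norm_sq {f : Ω → Vec n} (hf : MemLp f 2 P) :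
    ∫⁻ ω, ENNReal.ofReal (‖f ω‖ ^ 2) ∂P = ENNReal.ofReal (secondMoment P f f).trace := by
  rw [← ofReal_integral_eq_lintegral_ofReal (hf.integrable_norm_pow two_ne_zero)
    (ae_of_all _ fun ω => sq_nonneg _)]
  simp_rw [EuclideanSpace.real_norm_sq_eq, Matrix.trace, secondMoment, Matrix.diag_apply,
    Matrix.of_apply, sq]
  rw [integral_finsetSum _ fun j _ => integrable_eval_mul_eval hf hf j j]

theorem memLp_two_of_lintegral_norm_sq_ne_top {f : Ω → Vec n} (hf : AEStronglyMeasurable f P)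
    (h : ∫⁻ ω, ENNReal.ofReal (‖f ω‖ ^ 2) ∂P ≠ ∞) : MemLp f 2 P := by
  rw [memLp_two_iff_integrable_sq_norm hf]
  refine ⟨hf.norm.pow 2, ?_⟩
  rwa [hasFiniteIntegral_iff_ofReal (ae_of_all _ fun ω => sq_nonneg _), lt_top_iff_ne_top]

theorem trace_secondMoment_self_nonneg {f : Ω → Vec n} (hf : MemLp f 2 P) :
    0 ≤ (secondMoment P f f).trace :=
  (Matrix.nonneg_iff_posSemidef.1 (secondMoment_self_nonneg hf)).trace_nonneg

theorem lintegral_norm_add_sq {f g : Ω → Vec n} (hf : MemLp f 2 P) (hg : MemLp g 2 P)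
    (h : (secondMoment P f g).trace = 0) :
    ∫⁻ ω, ENNReal.ofReal (‖f ω + g ω‖ ^ 2) ∂P =
      ∫⁻ ω, ENNReal.ofReal (‖f ω‖ ^ 2) ∂P + ∫⁻ ω, ENNReal.ofReal (‖g ω‖ ^ 2) ∂P := by
  have hfg : MemLp (fun ω => f ω + g ω) 2 P := hf.add hg
  rw [lintegral_norm_sq hfg, lintegral_norm_sq hf, lintegral_norm_sq hg,
    ← ENNReal.ofReal_add (trace_secondMoment_self_nonneg hf) (trace_secondMoment_self_nonneg hg),
    secondMoment_add_self hf hg]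
  simp only [Matrix.trace_add, Matrix.trace_transpose, h, add_zero]

end SecondMoment

/-! ### Conditional expectations -/

section CondExp

variable {Ω : Type*} {m m' mΩ : MeasurableSpace Ω} {P : Measure Ω} [IsFiniteMeasure P]
  {n k l : ℕ} {X : Ω → Vec n}

theorem secondMoment_condExp_right (hm : m ≤ mΩ) {Y : Ω → Vec k} (hYm : StronglyMeasurable[m] Y)
    (hY : MemLp Y 2 P) (hX : MemLp X 2 P) :
    secondMoment P Y (P[X | m]) = secondMoment P Y X := by
  ext i j
  simp only [secondMoment, Matrix.of_apply]
  have heval : (fun ω => (P[X | m]) ω j) =ᵐ[P] P[fun ω => X ω j | m] :=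
    (EuclideanSpace.proj (𝕜 := ℝ) j).comp_condExp_comm (hX.integrable one_le_two)
  have hpull := condExp_mul_of_stronglyMeasurable_left (μ := P)
    ((EuclideanSpace.proj (𝕜 := ℝ) i).continuous.comp_stronglyMeasurable hYm)
    (g := fun ω => X ω j) (integrable_eval_mul_eval hY hX i j)
    ((hX.eval_piLp j).integrable one_le_two)
  rw [← integral_condExp hm (f := fun ω => Y ω i * X ω j)]
  refine integral_congr_ae ?_
  filter_upwards [heval, hpull] with ω heval hpull
  rw [heval]
  exact hpull.symm

theorem secondMoment_sub_condExp_eq_zero (hm : m ≤ mΩ) {Y : Ω → Vec k}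
    (hYm : StronglyMeasurable[m] Y) (hY : MemLp Y 2 P) (hX : MemLp X 2 P) :
    secondMoment P (fun ω => X ω - (P[X | m]) ω) Y = 0 := by
  rw [secondMoment_sub_left hX (hX.condExp one_le_two) hY, sub_eq_zero,
    ← secondMoment_transpose,
    ← secondMoment_condExp_right hm hYm hY hX, secondMoment_transpose]

theorem secondMoment_self_eq_add_condExp (hm : m ≤ mΩ) (hX : MemLp X 2 P) :
    secondMoment P X X = secondMoment P (fun ω => X ω - (P[X | m]) ω)
      (fun ω => X ω - (P[X | m]) ω) + secondMoment P (P[X | m]) (P[X | m]) := by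
  have hX' : MemLp (P[X | m]) 2 P := hX.condExp one_le_two
  have h := secondMoment_add_self (hX.sub hX') hX'
  simp only [Pi.sub_apply, sub_add_cancel] at h
  rw [h, Pi.sub_def, secondMoment_sub_condExp_eq_zero hm stronglyMeasurable_condExp hX' hX,
    Matrix.transpose_zero, add_zero, add_zero]

theorem secondMoment_condExp_le (hm : m ≤ mΩ) (hX : MemLp X 2 P) :
    secondMoment P (P[X | m]) (P[X | m]) ≤ secondMoment P X X := by
  rw [secondMoment_self_eq_add_condExp hm hX]
  exact le_add_of_nonneg_left (secondMoment_self_nonneg (hX.sub (hX.condExp one_le_two)))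

theorem secondMoment_condExp_mono (hmm' : m ≤ m') (hm' : m' ≤ mΩ) (hX : MemLp X 2 P) :
    secondMoment P (P[X | m]) (P[X | m]) ≤ secondMoment P (P[X | m']) (P[X | m']) := by
  have htower : P[P[X | m'] | m] =ᵐ[P] P[X | m] := condExp_condExp_of_le hmm' hm'
  rw [← secondMoment_congr_ae htower htower]
  exact secondMoment_condExp_le (hmm'.trans hm') (hX.condExp one_le_two)

theorem act_sub_act (A B : Matrix (Fin l) (Fin n) ℝ) (x y : Vec n) :
    act A x - act B y = act A (x - y) + act (A - B) y := by
  simp only [act, map_sub, LinearMap.sub_apply]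
  abel

theorem secondMoment_act_sub_act_condExp (hm : m ≤ mΩ) (A B : Matrix (Fin l) (Fin n) ℝ)
    {Y : Ω → Vec k} (hYm : StronglyMeasurable[m] Y) (hY : MemLp Y 2 P) (hX : MemLp X 2 P) :
    secondMoment P (fun ω => act A (X ω) - act B ((P[X | m]) ω)) Y =
      (A - B) * secondMoment P (P[X | m]) Y := by
  have hX' : MemLp (P[X | m]) 2 P := hX.condExp one_le_two
  have herr : MemLp (fun ω => X ω - (P[X | m]) ω) 2 P := hX.sub hX'
  simp only [act_sub_act A B]
  rw [secondMoment_add_left (memLp_act A herr) (memLp_act _ hX') hY,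
    secondMoment_act_left A herr hY, secondMoment_sub_condExp_eq_zero hm hYm hY hX, Matrix.mul_zero,
    zero_add, secondMoment_act_left _ hX' hY]

theorem secondMoment_act_sub_act_condExp_self (hm : m ≤ mΩ) (A B : Matrix (Fin l) (Fin n) ℝ)
    (hX : MemLp X 2 P) :
    secondMoment P (fun ω => act A (X ω) - act B ((P[X | m]) ω))
        (fun ω => act A (X ω) - act B ((P[X | m]) ω)) =
      A * (secondMoment P X X - secondMoment P (P[X | m]) (P[X | m])) * Aᵀ +
        (A - B) * secondMoment P (P[X | m]) (P[X | m]) * (A - B)ᵀ := by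
  have hX' : MemLp (P[X | m]) 2 P := hX.condExp one_le_two
  have herr : MemLp (fun ω => X ω - (P[X | m]) ω) 2 P := hX.sub hX'
  simp only [act_sub_act A B]
  rw [secondMoment_add_self (memLp_act A herr) (memLp_act _ hX'), secondMoment_act_self A herr,
    secondMoment_act_self _ hX', secondMoment_act_left A herr (memLp_act _ hX'),
    secondMoment_act_right _ herr hX',
    secondMoment_sub_condExp_eq_zero hm stronglyMeasurable_condExp hX' hX,
    secondMoment_self_eq_add_condExp hm hX]
  simp

end CondExp

/-! ### The response of the receiver -/

section Response

variable {Ω : Type*} [MeasurableSpace Ω] {P : Measure Ω} {p q t : ℕ} {X : Ω → Vec p}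
  {𝓛 : Losses p q t} {η η' : Fin 2 → SenderPolicy p} {γ γ' : ReceiverPolicy p t}

theorem act_leftInverse {R : Matrix (Fin q) (Fin t) ℝ} (hR : IsUnit (Rᵀ * R)) (v : Vec t) :
    act ((Rᵀ * R)⁻¹ * Rᵀ) (act R v) = v := by
  rw [← act_mul, Matrix.mul_assoc,
    Matrix.nonsing_inv_mul _ ((Matrix.isUnit_iff_isUnit_det _).1 hR), act, Matrix.toLpLin_one,
    LinearMap.id_apply]

/-- The least-squares gain `K = (Rrᵀ Rr)⁻¹ Rrᵀ Qr`: the loss `‖Qr x + Rr u‖²` of the receiver is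
minimized by `u = -K x`. -/
noncomputable def Losses.gain (𝓛 : Losses p q t) : Matrix (Fin t) (Fin p) ℝ :=
  (𝓛.Rrᵀ * 𝓛.Rr)⁻¹ * 𝓛.Rrᵀ * 𝓛.Qr

theorem Losses.lam_eq_mul_gain (𝓛 : Losses p q t) (i : Fin 2) :
    𝓛.lam i = 𝓛.R i * 𝓛.gain := by
  simp only [Losses.lam, Losses.gain, Matrix.mul_assoc]

theorem Losses.transpose_Rr_mul_sub_gain (hRr : IsUnit (𝓛.Rrᵀ * 𝓛.Rr)) :
    𝓛.Rrᵀ * (𝓛.Qr - 𝓛.Rr * 𝓛.gain) = 0 := by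
  rw [Matrix.mul_sub, Losses.gain, ← Matrix.mul_assoc, ← Matrix.mul_assoc, ← Matrix.mul_assoc,
    Matrix.mul_nonsing_inv _ ((Matrix.isUnit_iff_isUnit_det _).1 hRr), Matrix.one_mul, sub_self]

/-- The certainty-equivalent response `u = -K x̂`, which acts on the posterior mean as if it were
the state; a policy is only constrained almost surely on the signals that `η` produces. -/
def IsCertaintyEquivalent (P : Measure Ω) (X : Ω → Vec p) (𝓛 : Losses p q t)
    (η : Fin 2 → SenderPolicy p) (γ : ReceiverPolicy p t) : Prop :=
  ∀ᵐ ω ∂P, γ.1 (signals X η ω) = -act 𝓛.gain (posteriorMean P X η ω)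

theorem measurable_signals (hX : Measurable X) (η : Fin 2 → SenderPolicy p) :
    Measurable (signals X η) :=
  measurable_pi_lambda _ fun j => (η j).2.comp hX

theorem exists_isCertaintyEquivalent (P : Measure Ω) (X : Ω → Vec p) (𝓛 : Losses p q t)
    (η : Fin 2 → SenderPolicy p) : ∃ γ, IsCertaintyEquivalent P X 𝓛 η γ := by
  have hm : StronglyMeasurable[MeasurableSpace.comap (signals X η) inferInstance]
      fun ω => -act 𝓛.gain (posteriorMean P X η ω) :=
    ((continuous_act 𝓛.gain).comp_stronglyMeasurable stronglyMeasurable_condExp).neg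
  obtain ⟨γ, hγ, h⟩ := hm.exists_eq_measurable_comp
  exact ⟨⟨γ, hγ.measurable⟩, ae_of_all _ fun ω => (congrFun h ω).symm⟩

theorem IsCertaintyEquivalent.expectedCost_eq (h : IsCertaintyEquivalent P X 𝓛 η γ)
    (Q : Matrix (Fin q) (Fin p) ℝ) (R : Matrix (Fin q) (Fin t) ℝ) :
    expectedCost P X Q R η γ = ∫⁻ ω, ENNReal.ofReal
      (‖act Q (X ω) - act (R * 𝓛.gain) (posteriorMean P X η ω)‖ ^ 2) ∂P := by
  refine lintegral_congr_ae ?_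
  filter_upwards [h] with ω hω
  rw [hω, act_mul, sub_eq_add_neg, act, act, act, act, map_neg]

theorem IsCertaintyEquivalent.expectedCost_ne_top (h : IsCertaintyEquivalent P X 𝓛 η γ)
    (hX2 : MemLp X 2 P) (Q : Matrix (Fin q) (Fin p) ℝ) (R : Matrix (Fin q) (Fin t) ℝ) :
    expectedCost P X Q R η γ ≠ ∞ := by
  have hres : MemLp (fun ω => act Q (X ω) - act (R * 𝓛.gain) (posteriorMean P X η ω)) 2 P :=
    (memLp_act Q hX2).sub (memLp_act _ (hX2.condExp one_le_two))
  rw [h.expectedCost_eq, lintegral_norm_sq hres]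
  exact ENNReal.ofReal_ne_top

theorem memLp_response (hX : Measurable X) (hX2 : MemLp X 2 P) (hRr : IsUnit (𝓛.Rrᵀ * 𝓛.Rr))
    (h : expectedCost P X 𝓛.Qr 𝓛.Rr η γ ≠ ∞) : MemLp (fun ω => γ.1 (signals X η ω)) 2 P := by
  have hγm : StronglyMeasurable (fun ω => γ.1 (signals X η ω)) :=
    (γ.2.comp (measurable_signals hX η)).stronglyMeasurable
  have hloss : MemLp (fun ω => act 𝓛.Qr (X ω) + act 𝓛.Rr (γ.1 (signals X η ω))) 2 P :=
    memLp_two_of_lintegral_norm_sq_ne_top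
      (((continuous_act _).comp_stronglyMeasurable hX.stronglyMeasurable).add
        ((continuous_act _).comp_stronglyMeasurable hγm)).aestronglyMeasurable h
  have hinv := memLp_act ((𝓛.Rrᵀ * 𝓛.Rr)⁻¹ * 𝓛.Rrᵀ) (hloss.sub (memLp_act 𝓛.Qr hX2))
  simpa only [Pi.sub_apply, add_sub_cancel_left, act_leftInverse hRr] using hinv

variable [IsFiniteMeasure P]

-- By the normal equations, `Qr x - Rr K x̂` is orthogonal to `Rr w` for every random vector `w`
-- that is a function of the signals.
theorem IsCertaintyEquivalent.expectedCost_eq_add (h : IsCertaintyEquivalent P X 𝓛 η γ)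
    (hX : Measurable X) (hX2 : MemLp X 2 P) (hRr : IsUnit (𝓛.Rrᵀ * 𝓛.Rr))
    (hγ' : MemLp (fun ω => γ'.1 (signals X η ω)) 2 P) :
    expectedCost P X 𝓛.Qr 𝓛.Rr η γ' = expectedCost P X 𝓛.Qr 𝓛.Rr η γ +
      ∫⁻ ω, ENNReal.ofReal (‖act 𝓛.Rr
        (γ'.1 (signals X η ω) + act 𝓛.gain (posteriorMean P X η ω))‖ ^ 2) ∂P := by
  have hY : MemLp (posteriorMean P X η) 2 P := hX2.condExp one_le_two
  set w := fun ω => γ'.1 (signals X η ω) + act 𝓛.gain (posteriorMean P X η ω)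
  have hw : MemLp w 2 P := hγ'.add (memLp_act _ hY)
  have hwm : StronglyMeasurable[MeasurableSpace.comap (signals X η) inferInstance] w :=
    (γ'.2.comp (comap_measurable (signals X η))).stronglyMeasurable.add
      ((continuous_act 𝓛.gain).comp_stronglyMeasurable stronglyMeasurable_condExp)
  have hres : MemLp (fun ω => act 𝓛.Qr (X ω) - act (𝓛.Rr * 𝓛.gain) (posteriorMean P X η ω)) 2 P :=
    (memLp_act _ hX2).sub (memLp_act _ hY)
  have horth : (secondMoment P
      (fun ω => act 𝓛.Qr (X ω) - act (𝓛.Rr * 𝓛.gain) (posteriorMean P X η ω))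
      (fun ω => act 𝓛.Rr (w ω))).trace = 0 := by
    rw [secondMoment_act_right _ hres hw, Matrix.trace_mul_comm, posteriorMean,
      secondMoment_act_sub_act_condExp (measurable_signals hX η).comap_le _ _ hwm hw hX2,
      ← Matrix.mul_assoc, Losses.transpose_Rr_mul_sub_gain hRr, Matrix.zero_mul, Matrix.trace_zero]
  rw [h.expectedCost_eq, ← lintegral_norm_add_sq hres (memLp_act _ hw) horth]
  refine lintegral_congr fun ω => ?_
  rw [act_mul, act, act, act, act, act, map_add, sub_add_add_cancel]

theorem IsCertaintyEquivalent.expectedCost_le (h : IsCertaintyEquivalent P X 𝓛 η γ)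
    (hX : Measurable X) (hX2 : MemLp X 2 P) (hRr : IsUnit (𝓛.Rrᵀ * 𝓛.Rr))
    (γ' : ReceiverPolicy p t) :
    expectedCost P X 𝓛.Qr 𝓛.Rr η γ ≤ expectedCost P X 𝓛.Qr 𝓛.Rr η γ' := by
  by_cases hγ' : expectedCost P X 𝓛.Qr 𝓛.Rr η γ' = ∞
  · exact le_top.trans_eq hγ'.symm
  · rw [h.expectedCost_eq_add hX hX2 hRr (memLp_response hX hX2 hRr hγ')]
    exact le_self_add

theorem isCertaintyEquivalent_of_expectedCost_le (hX : Measurable X) (hX2 : MemLp X 2 P)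
    (hRr : IsUnit (𝓛.Rrᵀ * 𝓛.Rr)) (hγ : IsCertaintyEquivalent P X 𝓛 η γ)
    (hle : expectedCost P X 𝓛.Qr 𝓛.Rr η γ' ≤ expectedCost P X 𝓛.Qr 𝓛.Rr η γ) :
    IsCertaintyEquivalent P X 𝓛 η γ' := by
  have htop := hγ.expectedCost_ne_top hX2 𝓛.Qr 𝓛.Rr
  have hγ' := memLp_response hX hX2 hRr (ne_top_of_le_ne_top htop hle)
  have hY : MemLp (posteriorMean P X η) 2 P := hX2.condExp one_le_two
  have hw : MemLp (fun ω =>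
      act 𝓛.Rr (γ'.1 (signals X η ω) + act 𝓛.gain (posteriorMean P X η ω))) 2 P :=
    memLp_act 𝓛.Rr (hγ'.add (memLp_act 𝓛.gain hY))
  rw [hγ.expectedCost_eq_add hX hX2 hRr hγ'] at hle
  have hzero := nonpos_iff_eq_zero.1
    (ENNReal.le_of_add_le_add_left htop (hle.trans_eq (add_zero _).symm))
  rw [lintegral_eq_zero_iff' (hw.aestronglyMeasurable.norm.aemeasurable.pow_const 2).ennreal_ofReal]
    at hzero
  filter_upwards [hzero] with ω hω
  have hRw : act 𝓛.Rr (γ'.1 (signals X η ω) + act 𝓛.gain (posteriorMean P X η ω)) = 0 := by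
    simpa using hω
  have := congrArg (act ((𝓛.Rrᵀ * 𝓛.Rr)⁻¹ * 𝓛.Rrᵀ)) hRw
  rw [act_leftInverse hRr] at this
  exact eq_neg_of_add_eq_zero_left (this.trans (map_zero _))

theorem isBestResponseStrategy_iff (hX : Measurable X) (hX2 : MemLp X 2 P)
    (hRr : IsUnit (𝓛.Rrᵀ * 𝓛.Rr)) {γ : (Fin 2 → SenderPolicy p) → ReceiverPolicy p t} :
    IsBestResponseStrategy P X 𝓛 γ ↔ ∀ η, IsCertaintyEquivalent P X 𝓛 η (γ η) := by
  refine ⟨fun h η => ?_, fun h η => (h η).expectedCost_le hX hX2 hRr⟩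
  obtain ⟨γ₀, hγ₀⟩ := exists_isCertaintyEquivalent P X 𝓛 η
  exact isCertaintyEquivalent_of_expectedCost_le hX hX2 hRr hγ₀ (h η γ₀)

theorem exists_isBestResponseStrategy (hX : Measurable X) (hX2 : MemLp X 2 P)
    (hRr : IsUnit (𝓛.Rrᵀ * 𝓛.Rr)) : ∃ γ, IsBestResponseStrategy P X 𝓛 γ := by
  choose γ hγ using exists_isCertaintyEquivalent P X 𝓛
  exact ⟨γ, (isBestResponseStrategy_iff hX hX2 hRr).2 hγ⟩

theorem Losses.trace_eq_trace_V_mul (𝓛 : Losses p q t) (i : Fin 2)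
    (M S : Matrix (Fin p) (Fin p) ℝ) :
    (𝓛.Q i * (M - S) * (𝓛.Q i)ᵀ + (𝓛.Q i - 𝓛.lam i) * S * (𝓛.Q i - 𝓛.lam i)ᵀ).trace =
      (𝓛.Q i * M * (𝓛.Q i)ᵀ).trace + (𝓛.V i * S).trace := by
  have hcyc (A B : Matrix (Fin q) (Fin p) ℝ) : (A * S * Bᵀ).trace = (Bᵀ * A * S).trace :=
    Matrix.trace_mul_cycle A S Bᵀ
  simp only [Losses.V, Matrix.mul_sub, Matrix.sub_mul, Matrix.transpose_sub, Matrix.trace_add,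
    Matrix.trace_sub, hcyc]
  ring

theorem IsCertaintyEquivalent.expectedCost_sender_eq (h : IsCertaintyEquivalent P X 𝓛 η γ)
    (hX : Measurable X) (hX2 : MemLp X 2 P) (i : Fin 2) :
    expectedCost P X (𝓛.Q i) (𝓛.R i) η γ = ENNReal.ofReal
      ((𝓛.Q i * secondMoment P X X * (𝓛.Q i)ᵀ).trace +
        (𝓛.V i * posteriorCovariance P X η).trace) := by
  have hres : MemLp (fun ω => act (𝓛.Q i) (X ω) - act (𝓛.lam i) (posteriorMean P X η ω)) 2 P :=
    (memLp_act _ hX2).sub (memLp_act _ (hX2.condExp one_le_two))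
  rw [h.expectedCost_eq, ← 𝓛.lam_eq_mul_gain, lintegral_norm_sq hres, posteriorMean,
    secondMoment_act_sub_act_condExp_self (measurable_signals hX η).comap_le _ _ hX2,
    𝓛.trace_eq_trace_V_mul]
  rfl

theorem IsBestResponseStrategy.expectedCost_sender_le
    {γ : (Fin 2 → SenderPolicy p) → ReceiverPolicy p t} (h : IsBestResponseStrategy P X 𝓛 γ)
    (hX : Measurable X) (hX2 : MemLp X 2 P) (hRr : IsUnit (𝓛.Rrᵀ * 𝓛.Rr)) (i : Fin 2)
    (hle : (𝓛.V i * posteriorCovariance P X η).trace ≤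
      (𝓛.V i * posteriorCovariance P X η').trace) :
    expectedCost P X (𝓛.Q i) (𝓛.R i) η (γ η) ≤ expectedCost P X (𝓛.Q i) (𝓛.R i) η' (γ η') := by
  rw [isBestResponseStrategy_iff hX hX2 hRr] at h
  rw [(h η).expectedCost_sender_eq hX hX2, (h η').expectedCost_sender_eq hX hX2]
  gcongr

end Response

/-! ### Information revealed by the senders -/

section Information

variable {Ω : Type*} {p : ℕ} {X : Ω → Vec p} {η η' : Fin 2 → SenderPolicy p}

theorem comap_signals (X : Ω → Vec p) (η : Fin 2 → SenderPolicy p) :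
    MeasurableSpace.comap (signals X η) inferInstance =
      ⨆ j, MeasurableSpace.comap (fun ω => (η j).1 (X ω)) inferInstance := by
  simp only [MeasurableSpace.pi, MeasurableSpace.comap_iSup, MeasurableSpace.comap_comp]
  rfl

theorem comap_signals_of_forall_comap_eq {m : MeasurableSpace Ω}
    (hη : ∀ j, MeasurableSpace.comap (fun ω => (η j).1 (X ω)) inferInstance = m) :
    MeasurableSpace.comap (signals X η) inferInstance = m := by
  simp only [comap_signals, hη, ciSup_const]

theorem comap_signals_le_update {m : MeasurableSpace Ω}
    (hη : ∀ j, MeasurableSpace.comap (fun ω => (η j).1 (X ω)) inferInstance = m) (j : Fin 2)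
    (ηj : SenderPolicy p) :
    m ≤ MeasurableSpace.comap (signals X (Function.update η j ηj)) inferInstance := by
  have hrev : j.rev ≠ j := by fin_cases j <;> decide
  rw [comap_signals, ← hη j.rev]
  refine le_iSup_of_le j.rev ?_
  rw [Function.update_of_ne hrev]

variable [MeasurableSpace Ω] {P : Measure Ω} [IsFiniteMeasure P]

theorem posteriorCovariance_le (hX : Measurable X) (hX2 : MemLp X 2 P)
    (η : Fin 2 → SenderPolicy p) : posteriorCovariance P X η ≤ secondMoment P X X :=
  secondMoment_condExp_le (measurable_signals hX η).comap_le hX2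

theorem posteriorCovariance_mono (hX : Measurable X) (hX2 : MemLp X 2 P)
    (h : MeasurableSpace.comap (signals X η) inferInstance ≤
      MeasurableSpace.comap (signals X η') inferInstance) :
    posteriorCovariance P X η ≤ posteriorCovariance P X η' :=
  secondMoment_condExp_mono h (measurable_signals hX η').comap_le hX2

end Information

/-! ### Gaussian states -/

section Gaussian

variable {Ω : Type*} [MeasurableSpace Ω] {P : Measure Ω} {m n : ℕ}

theorem integral_act {f : Ω → Vec n} (A : Matrix (Fin m) (Fin n) ℝ) (hf : Integrable f P) :
    ∫ ω, act A (f ω) ∂P = act A (∫ ω, f ω ∂P) :=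
  (LinearMap.toContinuousLinearMap (Matrix.toEuclideanLin A)).integral_comp_comm hf

theorem integral_eval {f : Ω → Vec n} (hf : Integrable f P) (i : Fin n) :
    ∫ ω, f ω i ∂P = (∫ ω, f ω ∂P) i :=
  (EuclideanSpace.proj (𝕜 := ℝ) i).integral_comp_comm hf

theorem covariance_eval_eq_secondMoment [IsProbabilityMeasure P] {f : Ω → Vec m} {g : Ω → Vec n}
    (hf : MemLp f 2 P) (hg : MemLp g 2 P) (hf₀ : ∫ ω, f ω ∂P = 0) (i : Fin m) (j : Fin n) :
    cov[fun ω => f ω i, fun ω => g ω j; P] = secondMoment P f g i j := by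
  rw [covariance_eq_sub (hf.eval_piLp i) (hg.eval_piLp j),
    integral_eval (hf.integrable one_le_two), hf₀, PiLp.zero_apply, zero_mul, sub_zero]
  rfl

theorem indepFun_of_secondMoment_eq_zero {Y : Ω → Vec m} {Z : Ω → Vec n}
    (hYZ : HasGaussianLaw (fun ω => (Y ω, Z ω)) P) (hY₀ : ∫ ω, Y ω ∂P = 0)
    (h : secondMoment P Y Z = 0) : IndepFun Y Z P := by
  have := hYZ.isProbabilityMeasure
  have hcoord : HasGaussianLaw (fun ω => ((Y ω).ofLp, (Z ω).ofLp)) P :=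
    hYZ.map_fun ((EuclideanSpace.equiv (Fin m) ℝ).toContinuousLinearMap.prodMap
      (EuclideanSpace.equiv (Fin n) ℝ).toContinuousLinearMap)
  have hind := hcoord.indepFun_of_covariance_eval fun i j => by
    rw [covariance_eval_eq_secondMoment hYZ.fst.memLp_two hYZ.snd.memLp_two hY₀, h,
      Matrix.zero_apply]
  exact hind.comp (φ := WithLp.toLp 2) (ψ := WithLp.toLp 2) (by fun_prop) (by fun_prop)

theorem condExp_comap_ae_eq_act {X : Ω → Vec m} {Y : Ω → Vec n} (hX : Measurable X)
    (hY : Measurable Y) (hXY : HasGaussianLaw (fun ω => (X ω, Y ω)) P) (hX₀ : ∫ ω, X ω ∂P = 0)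
    (hY₀ : ∫ ω, Y ω ∂P = 0) {C : Matrix (Fin m) (Fin n) ℝ}
    (hC : secondMoment P X Y = C * secondMoment P Y Y) :
    P[X | MeasurableSpace.comap Y inferInstance] =ᵐ[P] fun ω => act C (Y ω) := by
  have := hXY.isProbabilityMeasure
  have hX2 := hXY.fst.memLp_two
  have hY2 := hXY.snd.memLp_two
  have hCY := memLp_act C hY2
  set E := fun ω => X ω - act C (Y ω)
  have hEm : Measurable E := hX.sub ((continuous_act C).measurable.comp hY)
  have hE₀ : ∫ ω, E ω ∂P = 0 := by
    rw [integral_sub (hX2.integrable one_le_two) (hCY.integrable one_le_two),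
      integral_act C (hY2.integrable one_le_two), hX₀, hY₀, act, map_zero, sub_zero]
  have hEY : HasGaussianLaw (fun ω => (E ω, Y ω)) P :=
    hXY.map_fun ((ContinuousLinearMap.fst ℝ (Vec m) (Vec n) -
      (LinearMap.toContinuousLinearMap (Matrix.toEuclideanLin C)).comp
        (ContinuousLinearMap.snd ℝ (Vec m) (Vec n))).prod
      (ContinuousLinearMap.snd ℝ (Vec m) (Vec n)))
  have hind : IndepFun E Y P := indepFun_of_secondMoment_eq_zero hEY hE₀ <| by
    rw [secondMoment_sub_left hX2 hCY hY2, secondMoment_act_left C hY2 hY2, hC, sub_self]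
  have hE : P[E | MeasurableSpace.comap Y inferInstance] =ᵐ[P] fun _ => 0 := by
    rw [← hE₀]
    exact condExp_indep_eq hEm.comap_le hY.comap_le (comap_measurable E).stronglyMeasurable hind
  have hCY' : P[fun ω => act C (Y ω) | MeasurableSpace.comap Y inferInstance] =
      fun ω => act C (Y ω) :=
    condExp_of_stronglyMeasurable hY.comap_le
      ((continuous_act C).comp_stronglyMeasurable (comap_measurable Y).stronglyMeasurable)
      (hCY.integrable one_le_two)
  have hsub := condExp_sub (hX2.integrable one_le_two) (hCY.integrable one_le_two)
    (MeasurableSpace.comap Y inferInstance)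
  rw [hCY'] at hsub
  filter_upwards [hE, hsub] with ω hE hsub
  exact sub_eq_zero.1 (hsub.symm.trans hE)

variable {X : Ω → Vec n} {Sx S : Matrix (Fin n) (Fin n) ℝ}

theorem hasGaussianLaw_of_map_eq (hlaw : P.map X = multivariateGaussian 0 Sx) :
    HasGaussianLaw X P :=
  ⟨by rw [hlaw]; infer_instance⟩

theorem integral_eq_zero_of_map_eq (hX : Measurable X)
    (hlaw : P.map X = multivariateGaussian 0 Sx) : ∫ ω, X ω ∂P = 0 := by
  have h : ∫ x, x ∂(P.map X) = 0 := by rw [hlaw, integral_id_multivariateGaussian]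
  rwa [integral_map hX.aemeasurable (by fun_prop)] at h

theorem secondMoment_eq_of_map_eq (hX : Measurable X) (hSx : Sx.PosSemidef)
    (hlaw : P.map X = multivariateGaussian 0 Sx) : secondMoment P X X = Sx := by
  have hX2 := (hasGaussianLaw_of_map_eq hlaw).memLp_two
  have := (hasGaussianLaw_of_map_eq hlaw).isProbabilityMeasure
  ext i j
  rw [← covariance_eval_eq_secondMoment hX2 hX2 (integral_eq_zero_of_map_eq hX hlaw),
    ← covariance_eval_multivariateGaussian (μ := 0) hSx i j, ← hlaw,
    covariance_map (by fun_prop) (by fun_prop) hX.aemeasurable]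
  rfl

theorem secondMoment_act_whiten_right (hX2 : MemLp X 2 P) (hSx : Sx.PosDef)
    (hcov : secondMoment P X X = Sx) (hT : IsStarProjection (whiten Sx S)) :
    secondMoment P X (fun ω => act (whiten Sx S * (CFC.sqrt Sx)⁻¹) (X ω)) =
      CFC.sqrt Sx * whiten Sx S := by
  have hWt : (CFC.sqrt Sx)⁻¹ᵀ = (CFC.sqrt Sx)⁻¹ := isSelfAdjoint_inv_sqrt
  have hTt : (whiten Sx S)ᵀ = whiten Sx S := hT.isSelfAdjoint
  have hSxW : Sx * (CFC.sqrt Sx)⁻¹ = CFC.sqrt Sx := by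
    calc Sx * (CFC.sqrt Sx)⁻¹ = CFC.sqrt Sx * CFC.sqrt Sx * (CFC.sqrt Sx)⁻¹ := by
          rw [sqrt_mul_sqrt hSx]
      _ = CFC.sqrt Sx := Matrix.mul_nonsing_inv_cancel_right _ _ (isUnit_det_sqrt hSx)
  rw [secondMoment_act_right _ hX2 hX2, hcov, Matrix.transpose_mul, hWt, hTt, ← Matrix.mul_assoc,
    hSxW]

theorem secondMoment_act_whiten_self (hX2 : MemLp X 2 P) (hSx : Sx.PosDef)
    (hcov : secondMoment P X X = Sx) (hT : IsStarProjection (whiten Sx S)) :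
    secondMoment P (fun ω => act (whiten Sx S * (CFC.sqrt Sx)⁻¹) (X ω))
      (fun ω => act (whiten Sx S * (CFC.sqrt Sx)⁻¹) (X ω)) = whiten Sx S := by
  rw [secondMoment_act_left _ hX2 (memLp_act _ hX2),
    secondMoment_act_whiten_right hX2 hSx hcov hT, Matrix.mul_assoc,
    ← Matrix.mul_assoc (CFC.sqrt Sx)⁻¹, Matrix.nonsing_inv_mul _ (isUnit_det_sqrt hSx),
    Matrix.one_mul, hT.isIdempotentElem.eq]

theorem posteriorCovariance_eq_of_comap_signals_eq (hX : Measurable X) (hSx : Sx.PosDef)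
    (hlaw : P.map X = multivariateGaussian 0 Sx) (hT : IsStarProjection (whiten Sx S))
    {η : Fin 2 → SenderPolicy n}
    (hη : MeasurableSpace.comap (signals X η) inferInstance = MeasurableSpace.comap
      (fun ω => act (whiten Sx S * (CFC.sqrt Sx)⁻¹) (X ω)) inferInstance) :
    posteriorCovariance P X η = S := by
  have hG := hasGaussianLaw_of_map_eq hlaw
  have := hG.isProbabilityMeasure
  have hX2 := hG.memLp_two
  have hX₀ := integral_eq_zero_of_map_eq hX hlaw
  have hcov := secondMoment_eq_of_map_eq hX hSx.posSemidef hlaw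
  have hXY := secondMoment_act_whiten_right hX2 hSx hcov hT
  have hYY := secondMoment_act_whiten_self hX2 hSx hcov hT
  set A := whiten Sx S * (CFC.sqrt Sx)⁻¹
  have hY₀ : ∫ ω, act A (X ω) ∂P = 0 := by
    rw [integral_act _ (hX2.integrable one_le_two), hX₀, act, map_zero]
  have hYm : Measurable fun ω => act A (X ω) := (continuous_act A).measurable.comp hX
  have hjoint : HasGaussianLaw (fun ω => (X ω, act A (X ω))) P :=
    hG.map_fun ((ContinuousLinearMap.id ℝ (Vec n)).prod
      (LinearMap.toContinuousLinearMap (Matrix.toEuclideanLin A)))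
  have hmean : posteriorMean P X η =ᵐ[P] fun ω => act (CFC.sqrt Sx) (act A (X ω)) := by
    rw [posteriorMean, hη]
    exact condExp_comap_ae_eq_act hX hYm hjoint hX₀ hY₀ (by rw [hXY, hYY])
  have hRt : (CFC.sqrt Sx)ᵀ = CFC.sqrt Sx := isSelfAdjoint_sqrt
  calc posteriorCovariance P X η = secondMoment P (posteriorMean P X η) (posteriorMean P X η) := rfl
    _ = CFC.sqrt Sx * whiten Sx S * CFC.sqrt Sx := by
      rw [secondMoment_congr_ae hmean hmean, secondMoment_act_self _ (memLp_act A hX2), hYY, hRt]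
    _ = S := sqrt_mul_whiten_mul_sqrt hSx

end Gaussian

section Linear

variable {p : ℕ} {S Sx L U : Matrix (Fin p) (Fin p) ℝ}

theorem comap_act_mul {Ω : Type*} {k l m : ℕ} {A : Matrix (Fin l) (Fin m) ℝ}
    {C : Matrix (Fin m) (Fin l) ℝ} (h : C * A = 1) (B : Matrix (Fin m) (Fin k) ℝ)
    (X : Ω → Vec k) :
    MeasurableSpace.comap (fun ω => act (A * B) (X ω)) inferInstance =
      MeasurableSpace.comap (fun ω => act B (X ω)) inferInstance := by
  have hB : (fun ω => act B (X ω)) = act C ∘ fun ω => act (A * B) (X ω) := by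
    funext ω
    rw [Function.comp_apply, ← act_mul, ← Matrix.mul_assoc, h, Matrix.one_mul]
  have hAB : (fun ω => act (A * B) (X ω)) = act A ∘ fun ω => act B (X ω) :=
    funext fun ω => act_mul A B (X ω)
  apply le_antisymm
  · rw [hAB, ← MeasurableSpace.comap_comp]
    exact MeasurableSpace.comap_mono (continuous_act A).measurable.comap_le
  · rw [hB, ← MeasurableSpace.comap_comp]
    exact MeasurableSpace.comap_mono (continuous_act C).measurable.comap_le

theorem whiten_mul_inv_sqrt_eq {d : Fin p → ℝ} (hd : whiten Sx S = U * Matrix.diagonal d * Uᵀ)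
    (hL : Lᵀ = (CFC.sqrt Sx)⁻¹ * U * Matrix.diagonal d) :
    whiten Sx S * (CFC.sqrt Sx)⁻¹ = U * L := by
  have hWt : (CFC.sqrt Sx)⁻¹ᵀ = (CFC.sqrt Sx)⁻¹ := isSelfAdjoint_inv_sqrt
  rw [hd, ← Matrix.transpose_transpose L, hL, Matrix.transpose_mul, Matrix.transpose_mul, hWt,
    Matrix.diagonal_transpose, Matrix.mul_assoc, Matrix.mul_assoc]

end Linear

end SignalingGame

open SignalingGame in
theorem theorem1_general {Ω : Type*} [MeasurableSpace Ω] (P : Measure Ω) [IsProbabilityMeasure P]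
    (p q t : ℕ) (𝓛 : Losses p q t) (hRr : IsUnit (𝓛.Rrᵀ * 𝓛.Rr))
    (Sx : Matrix (Fin p) (Fin p) ℝ) (hSx : Sx.PosDef)
    (X : Ω → Vec p) (hX : Measurable X)
    (hlaw : P.map X = multivariateGaussian 0 Sx)
    (i : Fin 2) (S₁ Sstar : Matrix (Fin p) (Fin p) ℝ)
    (hS : IsAlgorithmOutput Sx 𝓛 i S₁ Sstar)
    (η : Fin 2 → SenderPolicy p)
    (hη : ∀ j, MeasurableSpace.comap (fun ω => (η j).1 (X ω)) inferInstance =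
      MeasurableSpace.comap (fun ω =>
        act (whiten Sx Sstar * (CFC.sqrt Sx)⁻¹) (X ω)) inferInstance) :
    (∃ γ, IsBestResponseStrategy P X 𝓛 γ) ∧
    (∀ γ, IsBestResponseStrategy P X 𝓛 γ →
      IsEquilibrium P X 𝓛 η γ) ∧
    posteriorCovariance P X η = Sstar ∧
    ∃ Pr : Matrix (Fin p) (Fin p) ℝ, IsStarProjection Pr ∧
      Sstar = S₁ + CFC.sqrt (Sx - S₁) * Pr * CFC.sqrt (Sx - S₁) := by
  have hX2 := (hasGaussianLaw_of_map_eq hlaw).memLp_two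
  have hproj := hS.isStarProjection_whiten hSx
  have hcov := posteriorCovariance_eq_of_comap_signals_eq hX hSx hlaw hproj
    (comap_signals_of_forall_comap_eq hη)
  refine ⟨exists_isBestResponseStrategy hX hX2 hRr, fun γ hγ => ⟨hγ, fun j ηj => ?_⟩, hcov,
    exists_isStarProjection_eq_add hSx (hS.isStarProjection_whiten_left hSx) hproj hS.2.mem_Icc⟩
  refine hγ.expectedCost_sender_le hX hX2 hRr j ?_
  rw [hcov]
  refine hS.trace_V_mul_le j ⟨hcov ▸ posteriorCovariance_mono hX hX2 ?_, ?_⟩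
  · exact (comap_signals_of_forall_comap_eq hη).trans_le (comap_signals_le_update hη j ηj)
  · exact (posteriorCovariance_le hX hX2 _).trans_eq
      (secondMoment_eq_of_map_eq hX hSx.posSemidef hlaw)

theorem theorem1 {Ω : Type*} [MeasurableSpace Ω] (P : Measure Ω) [IsProbabilityMeasure P]
    (p q t : ℕ) (𝓛 : SignalingGame.Losses p q t) (hRr : IsUnit (𝓛.Rrᵀ * 𝓛.Rr))
    (Sx : Matrix (Fin p) (Fin p) ℝ) (hSx : Sx.PosDef)
    (X : Ω → SignalingGame.Vec p) (hX : Measurable X)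
    (hlaw : P.map X = multivariateGaussian 0 Sx)
    (i : Fin 2) (S₁ Sstar : Matrix (Fin p) (Fin p) ℝ)
    (hS : SignalingGame.IsAlgorithmOutput Sx 𝓛 i S₁ Sstar)
    (U : Matrix (Fin p) (Fin p) ℝ) (hU : U ∈ Matrix.orthogonalGroup (Fin p) ℝ)
    (d : Fin p → ℝ)
    (hd : SignalingGame.whiten Sx Sstar = U * Matrix.diagonal d * Uᵀ)
    (L : Matrix (Fin p) (Fin p) ℝ)
    (hL : Lᵀ = (CFC.sqrt Sx)⁻¹ * U * Matrix.diagonal d)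
    (G : Fin 2 → Matrix (Fin p) (Fin p) ℝ) (hG : ∀ j, (G j)ᵀ * G j = 1)
    (η : Fin 2 → SignalingGame.SenderPolicy p)
    (hη : ∀ j, η j = SignalingGame.linearPolicy (G j * L)) :
    -- a best-response strategy of the receiver exists, and with every one of them
    -- the linear policies are in equilibrium
    (∃ γ, SignalingGame.IsBestResponseStrategy P X 𝓛 γ) ∧
    (∀ γ, SignalingGame.IsBestResponseStrategy P X 𝓛 γ →
      SignalingGame.IsEquilibrium P X 𝓛 η γ) ∧
    -- the posterior covariance of the receiver is the computed one, and it has the stated form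
    SignalingGame.posteriorCovariance P X η = Sstar ∧
    ∃ Pr : Matrix (Fin p) (Fin p) ℝ, IsStarProjection Pr ∧
      Sstar = S₁ + CFC.sqrt (Sx - S₁) * Pr * CFC.sqrt (Sx - S₁) := by
  refine theorem1_general P p q t 𝓛 hRr Sx hSx X hX hlaw i S₁ Sstar hS η fun j => ?_
  rw [hη, SignalingGame.whiten_mul_inv_sqrt_eq hd hL,
    SignalingGame.comap_act_mul ((Matrix.mem_orthogonalGroup_iff' _ _).1 hU) L X]
  exact SignalingGame.comap_act_mul (hG j) L X
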